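/- Let $d\ge 2$ be an integer, let $\tau>0$, $b>0$, $\alpha=a_1+ia_2\in\mathbb C$, $\kappa_1\ge 0$ and $\kappa_2>0$, and, if $d\ge 3$, suppose in addition that $\tau b(d-2)\ge\kappa_2$. Let $Q_2=\mathbb R^2$ and, for $d\ge 3$, $Q_d=\{(x,y)\in\mathbb R^2 : y>0\}$. In the one-point compactification $\mathbb R^2\cup\{\infty\}$ of the plane let $\partial Q_2=\{\infty\}$ and, for $d\ge 3$, $\partial Q_d=\{(x,y)\in\mathbb R^2 : y=0\}\cup\{\infty\}$. For $f\in C^\infty(Q_d)$ let $$M_df=-\frac1\tau\,(x^2-y^2-a_1)\,\partial_xf-\frac1\tau\Big(2xy-a_2-\frac{\tau b(d-2)}{y}\Big)\partial_yf+\frac{\kappa_1}{\tau}\,\partial_x^2f+\frac{\kappa_2}{\tau}\,\partial_y^2f,$$ where the term $\tau b(d-2)/y$ is absent for $d=2$. Then there exists a function $\Phi_d\in C^\infty(Q_d)$ such that (I) $\Phi_d(x,y)\ge 0$ for all $(x,y)\in Q_d$; (II) $\Phi_d(x,y)\to\infty$ as $(x,y)\to\partial Q_d$, $(x,y)\in Q_d$;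 (IV) $M_d\Phi_d(x,y)\to-\infty$ as $(x,y)\to\partial Q_d$, $(x,y)\in Q_d$. -/

import Mathlib

open Filter Topology
open scoped ContDiff

noncomputable section

namespace InertialParticles

/-- The state space `Q_d`: the whole plane for `d = 2`, the open upper half-plane for `d ≥ 3`. -/
def stateSpace (d : ℕ) : Set (ℝ × ℝ) :=
  if d = 2 then Set.univ else {p | 0 < p.2}

/-- The boundary `∂Q_d`, as a subset of the one-point compactification of the plane: the point
at infinity for `d = 2`, and the point at infinity together with the line `y = 0` for `d ≥ 3`. -/
def boundary (d : ℕ) : Set (OnePoint (ℝ × ℝ)) :=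
  if d = 2 then {OnePoint.infty}
  else insert OnePoint.infty ((fun p : ℝ × ℝ => (p : OnePoint (ℝ × ℝ))) '' {p | p.2 = 0})

/-- The filter of `(x, y) → ∂Q_d` with `(x, y) ∈ Q_d`: its sets contain the points of `Q_d` that
lie in some neighbourhood of `∂Q_d` in the one-point compactification of the plane. -/
def toBoundary (d : ℕ) : Filter (ℝ × ℝ) :=
  comap (fun p : ℝ × ℝ => (p : OnePoint (ℝ × ℝ))) (𝓝ˢ (boundary d)) ⊓ 𝓟 (stateSpace d)

/-- The partial derivative `∂_x f`. -/
def partialX (f : ℝ × ℝ → ℝ) (p : ℝ × ℝ) : ℝ := deriv (fun s => f (s, p.2)) p.1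

/-- The partial derivative `∂_y f`. -/
def partialY (f : ℝ × ℝ → ℝ) (p : ℝ × ℝ) : ℝ := deriv (fun s => f (p.1, s)) p.2

/-- The generator `M_d`, with `α = a₁ + i a₂`. For `d = 2` the term with `y⁻¹` vanishes. -/
def generator (d : ℕ) (τ b κ₁ κ₂ : ℝ) (α : ℂ) (f : ℝ × ℝ → ℝ) (p : ℝ × ℝ) : ℝ :=
  -(1 / τ) * (p.1 ^ 2 - p.2 ^ 2 - α.re) * partialX f p
    - (1 / τ) * (2 * p.1 * p.2 - α.im - τ * b * ((d : ℝ) - 2) * p.2⁻¹) * partialY f p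
    + (κ₁ / τ) * partialX (partialX f) p
    + (κ₂ / τ) * partialY (partialY f) p

end InertialParticles

end

/-!
Write `r = |(x, y)|`, `c = τ b (d - 2)`, and consider `τ M_d`. In complex notation the dominant
part of the drift is `-z²`. It decreases `log r` at rate `x`, so it explodes along the negative
`x`-axis, while all other trajectories turn around and reach the positive side. Only the vertical
diffusion `κ₂ ∂_y²` removes the process from the negative axis, on the scale `y ~ r ^ (-1 / 2)`.
The function `q = r² (r + x) + 3κ₂ / 10` sees this scale, since `r² (r + x) ≈ r y² / 2` there, and
the derivative of `r² (r + x)` along the drift is `r - 4x` times itself. With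
`Φ₀ = 4 log r - log q + 2κ₂ / q` the terms linear in `r` sum to at most `-r`; the reason is a
polynomial inequality in the single variable `κ₂ / q` (`five_le_profile`), and the remaining terms
are bounded except for the one coming from the imaginary part of `α`, which is `O(√r)`. The term with `c y⁻¹` is bounded above because
`∂_y Φ₀` carries a factor `y` and `∂_y q / y > 0`. Hence `τ M_d Φ₀ ≤ -r / 2 + K` for `r ≥ 1`
(`exists_scaledGenerator_rawLyapunov_le`).

A smooth truncation makes `Φ₀` nonnegative and smooth on the whole plane without changing it near
infinity, which settles `d = 2`. For `d ≥ 3` the function `log (1 + log (1 + 1 / y)) / 8` is added.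
As `c ≥ κ₂`, it contributes at most `r / 4 + O(1 / y)` minus a term that behaves like a multiple
of `1 / (y log y)²` near `y = 0`. The first summand is absorbed by `-r / 2`; the last term dominates
`O(1 / y)`, which is also the size of the generator of the truncated function on bounded sets
(`exists_scaledGenerator_halfPlaneLyapunov_le`).
-/

noncomputable section

namespace InertialParticles

/-! ### The potential and its derivatives -/

/-- The Euclidean norm of `(x, y)`; the norm of `ℝ × ℝ` itself is the sup norm. -/
def rad (p : ℝ × ℝ) : ℝ := √(p.1 ^ 2 + p.2 ^ 2)

/-- The function `q = r² (r + x) + m`. It is of order `r³` away from the negative `x`-axis, and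
near it `q - m` is about `r y² / 2`, the square of `y` measured in the scale `r ^ (-1 / 2)` on
which vertical diffusion and quadratic drift balance. -/
def pot (m : ℝ) (p : ℝ × ℝ) : ℝ := rad p ^ 2 * (rad p + p.1) + m

/-- The derivative `∂_x q`. -/
def potX (p : ℝ × ℝ) : ℝ := (rad p + p.1) * (rad p + 2 * p.1)

/-- The derivative `∂_y q`. -/
def potY (p : ℝ × ℝ) : ℝ := p.2 * (3 * rad p + 2 * p.1)

theorem rad_nonneg (p : ℝ × ℝ) : 0 ≤ rad p := Real.sqrt_nonneg _

theorem rad_sq (p : ℝ × ℝ) : rad p ^ 2 = p.1 ^ 2 + p.2 ^ 2 :=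
  Real.sq_sqrt (by positivity)

theorem abs_fst_le_rad (p : ℝ × ℝ) : |p.1| ≤ rad p :=
  Real.abs_le_sqrt (by nlinarith [sq_nonneg p.2])

theorem abs_snd_le_rad (p : ℝ × ℝ) : |p.2| ≤ rad p :=
  Real.abs_le_sqrt (by nlinarith [sq_nonneg p.1])

theorem rad_add_fst_nonneg (p : ℝ × ℝ) : 0 ≤ rad p + p.1 := by
  linarith [neg_abs_le p.1, abs_fst_le_rad p]

theorem continuous_rad : Continuous rad := by unfold rad; fun_prop

theorem le_pot (m : ℝ) (p : ℝ × ℝ) : m ≤ pot m p := by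
  have := mul_nonneg (sq_nonneg (rad p)) (rad_add_fst_nonneg p)
  unfold pot; linarith

theorem pot_pos {m : ℝ} (hm : 0 < m) (p : ℝ × ℝ) : 0 < pot m p := hm.trans_le (le_pot m p)

theorem sq_add_sq_ne_zero_of_rad_pos {x y : ℝ} (h : 0 < rad (x, y)) : x ^ 2 + y ^ 2 ≠ 0 := by
  intro h1; simp [rad, h1] at h

theorem hasDerivAt_rad_fst {x y : ℝ} (h : 0 < rad (x, y)) :
    HasDerivAt (fun s => rad (s, y)) (x / rad (x, y)) x := by
  have h0 := sq_add_sq_ne_zero_of_rad_pos h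
  have := (((hasDerivAt_id x).pow 2).add_const (y ^ 2)).sqrt (by simpa using h0)
  refine this.congr_deriv ?_
  simp [rad]
  field_simp

theorem hasDerivAt_rad_snd {x y : ℝ} (h : 0 < rad (x, y)) :
    HasDerivAt (fun s => rad (x, s)) (y / rad (x, y)) y := by
  have h0 := sq_add_sq_ne_zero_of_rad_pos h
  have := (((hasDerivAt_id y).pow 2).const_add (x ^ 2)).sqrt (by simpa using h0)
  refine this.congr_deriv ?_
  simp [rad]
  field_simp

theorem hasDerivAt_pot_fst (m : ℝ) {x y : ℝ} (h : 0 < rad (x, y)) :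
    HasDerivAt (fun s => pot m (s, y)) (potX (x, y)) x := by
  have hr := hasDerivAt_rad_fst h
  refine HasDerivAt.congr_deriv (((hr.pow 2).mul (hr.add (hasDerivAt_id x))).add_const m) ?_
  simp only [potX, Pi.add_apply, Pi.pow_apply, id]
  field_simp
  push_cast
  ring

theorem hasDerivAt_pot_snd (m : ℝ) {x y : ℝ} (h : 0 < rad (x, y)) :
    HasDerivAt (fun s => pot m (x, s)) (potY (x, y)) y := by
  have hr := hasDerivAt_rad_snd h
  refine HasDerivAt.congr_deriv (((hr.pow 2).mul (hr.add_const x)).add_const m) ?_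
  simp only [potY, Pi.pow_apply]
  field_simp
  push_cast
  ring

theorem hasDerivAt_potX_fst {x y : ℝ} (h : 0 < rad (x, y)) :
    HasDerivAt (fun s => potX (s, y)) (3 * (rad (x, y) + x) ^ 2 / rad (x, y)) x := by
  have hr := hasDerivAt_rad_fst h
  refine HasDerivAt.congr_deriv ((hr.add (hasDerivAt_id x)).mul (hr.add ((hasDerivAt_id x).const_mul 2))) ?_
  simp only [Pi.add_apply, id]
  field_simp
  ring

theorem hasDerivAt_potY_snd {x y : ℝ} (h : 0 < rad (x, y)) :
    HasDerivAt (fun s => potY (x, s))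
      (3 * rad (x, y) + 2 * x + 3 * y ^ 2 / rad (x, y)) y := by
  have hr := hasDerivAt_rad_snd h
  refine HasDerivAt.congr_deriv ((hasDerivAt_id y).mul ((hr.const_mul 3).add_const (2 * x))) ?_
  simp only [id]
  field_simp

/-- The coefficient of `-∇q` in the gradient of `-log q + 2κ / q`. -/
def gradCoeff (κ q : ℝ) : ℝ := (q + 2 * κ) / q ^ 2

/-- Minus the derivative of `gradCoeff κ`. -/
def hessCoeff (κ q : ℝ) : ℝ := (q + 4 * κ) / q ^ 3

theorem hasDerivAt_gradCoeff (κ : ℝ) {q : ℝ} (hq : q ≠ 0) :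
    HasDerivAt (gradCoeff κ) (-hessCoeff κ q) q := by
  refine HasDerivAt.congr_deriv
    (((hasDerivAt_id q).add_const (2 * κ)).div ((hasDerivAt_id q).pow 2) (by simpa)) ?_
  simp only [hessCoeff, id]
  field_simp
  push_cast
  ring

/-- The Lyapunov function near infinity, `4 log r - log q + 2κ / q` up to a constant, with
`q = r² (r + x) + 3κ / 10`. The additive constant makes it nonpositive on the
unit disc. -/
def rawLyapunov (κ : ℝ) (p : ℝ × ℝ) : ℝ :=
  2 * Real.log (p.1 ^ 2 + p.2 ^ 2) - Real.log (pot (3 * κ / 10) p) + 2 * κ / pot (3 * κ / 10) p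
    - (7 - Real.log (3 * κ / 10))

theorem hasDerivAt_logTerms (κ : ℝ) {q : ℝ} (hq : q ≠ 0) :
    HasDerivAt (fun t => -Real.log t + 2 * κ / t) (-gradCoeff κ q) q := by
  refine HasDerivAt.congr_deriv ((Real.hasDerivAt_log hq).neg.add
    ((hasDerivAt_const q (2 * κ)).div (hasDerivAt_id q) hq)) ?_
  simp only [gradCoeff]
  field_simp
  ring

theorem hasDerivAt_rawLyapunov_fst {κ : ℝ} (hκ : 0 < κ) {x y : ℝ} (h : 0 < rad (x, y)) :
    HasDerivAt (fun s => rawLyapunov κ (s, y))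
      (4 * x / (x ^ 2 + y ^ 2) - gradCoeff κ (pot (3 * κ / 10) (x, y)) * potX (x, y)) x := by
  have h0 := sq_add_sq_ne_zero_of_rad_pos h
  have hq := (pot_pos (by positivity : 0 < 3 * κ / 10) (x, y)).ne'
  have h1 := ((((hasDerivAt_id x).pow 2).add_const (y ^ 2)).log (by simpa using h0)).const_mul 2
  have h2 := (hasDerivAt_logTerms κ hq).comp x (hasDerivAt_pot_fst (3 * κ / 10) h)
  have h3 := (h1.add h2).sub_const (7 - Real.log (3 * κ / 10))
  refine (h3.congr_deriv ?_).congr_of_eventuallyEq (Eventually.of_forall fun s => ?_)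
  · simp; ring
  · simp [rawLyapunov]; ring

theorem hasDerivAt_rawLyapunov_snd {κ : ℝ} (hκ : 0 < κ) {x y : ℝ} (h : 0 < rad (x, y)) :
    HasDerivAt (fun s => rawLyapunov κ (x, s))
      (4 * y / (x ^ 2 + y ^ 2) - gradCoeff κ (pot (3 * κ / 10) (x, y)) * potY (x, y)) y := by
  have h0 := sq_add_sq_ne_zero_of_rad_pos h
  have hq := (pot_pos (by positivity : 0 < 3 * κ / 10) (x, y)).ne'
  have h1 := ((((hasDerivAt_id y).pow 2).const_add (x ^ 2)).log (by simpa using h0)).const_mul 2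
  have h2 := (hasDerivAt_logTerms κ hq).comp y (hasDerivAt_pot_snd (3 * κ / 10) h)
  have h3 := (h1.add h2).sub_const (7 - Real.log (3 * κ / 10))
  refine (h3.congr_deriv ?_).congr_of_eventuallyEq (Eventually.of_forall fun s => ?_)
  · simp; ring
  · simp [rawLyapunov]; ring

theorem hasDerivAt_rawLyapunov_fst_fst {κ : ℝ} (hκ : 0 < κ) {x y : ℝ} (h : 0 < rad (x, y)) :
    HasDerivAt
      (fun s => 4 * s / (s ^ 2 + y ^ 2) - gradCoeff κ (pot (3 * κ / 10) (s, y)) * potX (s, y))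
      (4 * (y ^ 2 - x ^ 2) / (x ^ 2 + y ^ 2) ^ 2
        - gradCoeff κ (pot (3 * κ / 10) (x, y)) * (3 * (rad (x, y) + x) ^ 2 / rad (x, y))
        + hessCoeff κ (pot (3 * κ / 10) (x, y)) * potX (x, y) ^ 2) x := by
  have h0 := sq_add_sq_ne_zero_of_rad_pos h
  have hq := (pot_pos (by positivity : 0 < 3 * κ / 10) (x, y)).ne'
  have h1 := ((hasDerivAt_id x).const_mul 4).div
    (((hasDerivAt_id x).pow 2).add_const (y ^ 2)) (by simpa using h0)
  have h2 := (hasDerivAt_gradCoeff κ hq).comp x (hasDerivAt_pot_fst (3 * κ / 10) h)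
  refine (h1.sub (h2.mul (hasDerivAt_potX_fst h))).congr_deriv ?_
  simp
  field_simp
  ring

theorem hasDerivAt_rawLyapunov_snd_snd {κ : ℝ} (hκ : 0 < κ) {x y : ℝ} (h : 0 < rad (x, y)) :
    HasDerivAt
      (fun s => 4 * s / (x ^ 2 + s ^ 2) - gradCoeff κ (pot (3 * κ / 10) (x, s)) * potY (x, s))
      (4 * (x ^ 2 - y ^ 2) / (x ^ 2 + y ^ 2) ^ 2
        - gradCoeff κ (pot (3 * κ / 10) (x, y))
          * (3 * rad (x, y) + 2 * x + 3 * y ^ 2 / rad (x, y))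
        + hessCoeff κ (pot (3 * κ / 10) (x, y)) * potY (x, y) ^ 2) y := by
  have h0 := sq_add_sq_ne_zero_of_rad_pos h
  have hq := (pot_pos (by positivity : 0 < 3 * κ / 10) (x, y)).ne'
  have h1 := ((hasDerivAt_id y).const_mul 4).div
    (((hasDerivAt_id y).pow 2).const_add (x ^ 2)) (by simpa using h0)
  have h2 := (hasDerivAt_gradCoeff κ hq).comp y (hasDerivAt_pot_snd (3 * κ / 10) h)
  refine (h1.sub (h2.mul (hasDerivAt_potY_snd h))).congr_deriv ?_
  simp
  field_simp
  ring

/-! ### The estimate near infinity -/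

theorem gradCoeff_nonneg {κ q : ℝ} (hκ : 0 < κ) (hq : 0 < q) : 0 ≤ gradCoeff κ q := by
  unfold gradCoeff; positivity

theorem hessCoeff_nonneg {κ q : ℝ} (hκ : 0 < κ) (hq : 0 < q) : 0 ≤ hessCoeff κ q := by
  unfold hessCoeff; positivity

theorem gradCoeff_mul_le {κ q : ℝ} (hκ : 0 < κ) (hq : 3 * κ / 10 ≤ q) :
    gradCoeff κ q * q ≤ 8 := by
  have : 0 < q := by linarith
  have h : gradCoeff κ q * q = (q + 2 * κ) / q := by unfold gradCoeff; field_simp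
  rw [h, div_le_iff₀ this]; linarith

theorem hessCoeff_mul_sq_le {κ q : ℝ} (hκ : 0 < κ) (hq : 3 * κ / 10 ≤ q) :
    hessCoeff κ q * q ^ 2 ≤ 15 := by
  have : 0 < q := by linarith
  have h : hessCoeff κ q * q ^ 2 = (q + 4 * κ) / q := by unfold hessCoeff; field_simp
  rw [h, div_le_iff₀ this]; linarith

theorem hess_mul_le_of_sq_le {κ q a C : ℝ} (hκ : 0 < κ) (hq : 3 * κ / 10 ≤ q)
    (hC : 0 ≤ C) (ha : a ≤ C * q ^ 2) : hessCoeff κ q * a ≤ 15 * C := by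
  have h0 : 0 < q := by linarith
  calc hessCoeff κ q * a ≤ hessCoeff κ q * (C * q ^ 2) :=
        mul_le_mul_of_nonneg_left ha (hessCoeff_nonneg hκ h0)
    _ = hessCoeff κ q * q ^ 2 * C := by ring
    _ ≤ 15 * C := mul_le_mul_of_nonneg_right (hessCoeff_mul_sq_le hκ hq) hC

/-- The inequality that fixes the shape of `-log q + 2κ / q`. With `u = κ / q` the right-hand side
is `5 + 7.5 u - 8.4 u² + 2.4 u³`. Near the negative `x`-axis it is the rate, in units of `r`, at
which drift and diffusion together decrease this function; it has to exceed `4`, the rate at which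
`4 log r` increases there. Without the summand `2κ / q` no choice of the shift in `q` achieves
this. -/
theorem five_le_profile {κ q : ℝ} (hκ : 0 < κ) (hq : 0 < q) :
    5 ≤ 5 * gradCoeff κ q * (q - 3 * κ / 10) + κ * gradCoeff κ q
      - 2 * κ * hessCoeff κ q * (q - 3 * κ / 10) := by
  have h : 5 * gradCoeff κ q * (q - 3 * κ / 10) + κ * gradCoeff κ q
      - 2 * κ * hessCoeff κ q * (q - 3 * κ / 10)
      = 5 + κ / q * (12 / 5 * (κ / q - 7 / 4) ^ 2 + 3 / 20) := by
    unfold gradCoeff hessCoeff; field_simp; ring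
  rw [h]
  have : 0 ≤ κ / q * (12 / 5 * (κ / q - 7 / 4) ^ 2 + 3 / 20) := by positivity
  linarith

/-- The quadratic drift and the vertical diffusion applied to `4 log r - log q + 2κ / q`, without
the bounded diffusion term of `4 log r`; here `h` stands for `r + x`. The coefficients of `h` that
are not damped by `q` cancel, so that one estimate serves all directions in the plane. -/
theorem drift_add_diffusion_le {κ r h q : ℝ} (hκ : 0 < κ) (hr : 1 ≤ r) (h0 : 0 ≤ h)
    (h2 : h ≤ 2 * r) (hq : q = r ^ 2 * h + 3 * κ / 10) :
    4 * (r - h) - gradCoeff κ q * (r ^ 2 * h * (5 * r - 4 * h))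
      + κ * (-gradCoeff κ q * (r + 8 * h - 3 * h ^ 2 / r)
        + hessCoeff κ q * (h * (2 * r - h) * (r + 2 * h) ^ 2)) ≤ -r + 240 * κ := by
  have hr0 : 0 < r := by linarith
  have hv0 : 0 ≤ r ^ 2 * h := by positivity
  have hqm : 3 * κ / 10 ≤ q := by linarith
  have hq0 : 0 < q := by linarith
  have hv : r ^ 2 * h = q - 3 * κ / 10 := by linarith
  have hhv : h ≤ r ^ 2 * h := le_mul_of_one_le_left h0 (one_le_pow₀ hr)
  have hhq : h ≤ q := by linarith
  have hg := gradCoeff_nonneg hκ hq0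
  have hg' := hessCoeff_nonneg hκ hq0
  have hF := five_le_profile hκ hq0
  set g := gradCoeff κ q with hgd
  set g' := hessCoeff κ q
  have e1 : r * 5 ≤ r * (5 * g * (r ^ 2 * h) + κ * g - 2 * κ * g' * (r ^ 2 * h)) := by
    rw [hv]; exact mul_le_mul_of_nonneg_left hF hr0.le
  have e2 : h * (g * (r ^ 2 * h)) ≤ h + 2 * κ := by
    have : g * (r ^ 2 * h) ≤ (q + 2 * κ) / q := by
      have : g * q = (q + 2 * κ) / q := by rw [hgd]; unfold gradCoeff; field_simp
      rw [← this]; exact mul_le_mul_of_nonneg_left (by linarith) hg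
    calc h * (g * (r ^ 2 * h)) ≤ h * ((q + 2 * κ) / q) := mul_le_mul_of_nonneg_left this h0
      _ = h + 2 * κ * (h / q) := by field_simp
      _ ≤ h + 2 * κ * 1 := by gcongr; exact (div_le_one hq0).2 hhq
      _ = _ := by ring
  have e3 : 0 ≤ κ * (g * (8 * h - 3 * h ^ 2 / r)) := by
    have : 0 ≤ 8 * h - 3 * h ^ 2 / r := by
      rw [sub_nonneg, div_le_iff₀ hr0]; nlinarith
    positivity
  have e4 : κ * (g' * (h * (2 * r - h) * (r + 2 * h) ^ 2 - 2 * r ^ 3 * h)) ≤ κ * (15 * 15) := by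
    refine mul_le_mul_of_nonneg_left (hess_mul_le_of_sq_le hκ hqm (by norm_num) ?_) hκ.le
    calc h * (2 * r - h) * (r + 2 * h) ^ 2 - 2 * r ^ 3 * h
        = h ^ 2 * (7 * r ^ 2 + 4 * r * h - 4 * h ^ 2) := by ring
      _ ≤ h ^ 2 * (15 * r ^ 2) := by
          refine mul_le_mul_of_nonneg_left ?_ (sq_nonneg h)
          nlinarith [mul_le_mul_of_nonneg_left h2 hr0.le, sq_nonneg h]
      _ = 15 * (r * h) ^ 2 := by ring
      _ ≤ 15 * q ^ 2 := by
          have : r * h ≤ q := by nlinarith [mul_nonneg (mul_nonneg hr0.le h0) (sub_nonneg.2 hr)]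
          have : (r * h) ^ 2 ≤ q ^ 2 := pow_le_pow_left₀ (by positivity) this 2
          linarith
  linarith

/-- Since `y² ≤ 2 r h` and `q = r² h + m`, the quotient `r |y| / q` is `O(√r)`; the form with a
free parameter `η` avoids the square root. -/
theorem rad_mul_abs_le {r h y q m η : ℝ} (hr : 0 ≤ r) (h0 : 0 ≤ h) (hm : 0 < m) (hη : 0 < η)
    (hq : q = r ^ 2 * h + m) (hy : y ^ 2 = h * (2 * r - h)) :
    r * |y| ≤ (η / m * r + 1 / η) * q := by
  have hv0 : 0 ≤ r ^ 2 * h := by positivity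
  have h1 : 2 * |y| ≤ η + y ^ 2 / η := by
    rw [← sub_nonneg]
    have : η + y ^ 2 / η - 2 * |y| = (|y| - η) ^ 2 / η := by
      field_simp; rw [sub_sq, sq_abs]; ring
    rw [this]; positivity
  have h2 : r * η ≤ η / m * r * q := by
    have : η / m * r * q = r * η + η / m * r * (r ^ 2 * h) := by rw [hq]; field_simp; ring
    rw [this]
    have : 0 ≤ η / m * r * (r ^ 2 * h) := by positivity
    linarith
  have h3 : r * (y ^ 2 / η) ≤ 2 * (1 / η * q) := by
    have h5 : r * y ^ 2 ≤ 2 * q := by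
      rw [hy, hq]; nlinarith [mul_nonneg hr (sq_nonneg h)]
    calc r * (y ^ 2 / η) = 1 / η * (r * y ^ 2) := by ring
      _ ≤ 1 / η * (2 * q) := mul_le_mul_of_nonneg_left h5 (by positivity)
      _ = 2 * (1 / η * q) := by ring
  have h4 : 0 ≤ r * η := by positivity
  nlinarith [mul_le_mul_of_nonneg_left h1 hr]

/-! ### The generator near infinity -/

/-- The generator multiplied by `τ`, with `c = τ b (d - 2)` as the coefficient of `y⁻¹`. -/
def scaledGenerator (c κ₁ κ₂ : ℝ) (α : ℂ) (f : ℝ × ℝ → ℝ) (p : ℝ × ℝ) : ℝ :=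
  -(p.1 ^ 2 - p.2 ^ 2 - α.re) * partialX f p - (2 * p.1 * p.2 - α.im - c * p.2⁻¹) * partialY f p
    + κ₁ * partialX (partialX f) p + κ₂ * partialY (partialY f) p

theorem generator_eq (d : ℕ) {τ : ℝ} (b κ₁ κ₂ : ℝ) (α : ℂ) (f : ℝ × ℝ → ℝ) (p : ℝ × ℝ) :
    generator d τ b κ₁ κ₂ α f p
      = 1 / τ * scaledGenerator (τ * b * ((d : ℝ) - 2)) κ₁ κ₂ α f p := by
  unfold generator scaledGenerator; ring

theorem partialX_eqOn {U : Set (ℝ × ℝ)} (hU : IsOpen U) {f g : ℝ × ℝ → ℝ}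
    (h : ∀ p ∈ U, f p = g p) : ∀ p ∈ U, partialX f p = partialX g p := by
  intro p hp
  refine EventuallyEq.deriv_eq ?_
  have hc : ContinuousAt (fun s : ℝ => (s, p.2)) p.1 := by fun_prop
  filter_upwards [hc (hU.mem_nhds hp)] with s hs using h _ hs

theorem partialY_eqOn {U : Set (ℝ × ℝ)} (hU : IsOpen U) {f g : ℝ × ℝ → ℝ}
    (h : ∀ p ∈ U, f p = g p) : ∀ p ∈ U, partialY f p = partialY g p := by
  intro p hp
  refine EventuallyEq.deriv_eq ?_
  have hc : ContinuousAt (fun s : ℝ => (p.1, s)) p.2 := by fun_prop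
  filter_upwards [hc (hU.mem_nhds hp)] with s hs using h _ hs

theorem scaledGenerator_eqOn {c κ₁ κ₂ : ℝ} {α : ℂ} {U : Set (ℝ × ℝ)} (hU : IsOpen U)
    {f g : ℝ × ℝ → ℝ} (h : ∀ p ∈ U, f p = g p) :
    ∀ p ∈ U, scaledGenerator c κ₁ κ₂ α f p = scaledGenerator c κ₁ κ₂ α g p := by
  intro p hp
  have hx := partialX_eqOn hU h
  have hy := partialY_eqOn hU h
  simp only [scaledGenerator, hx p hp, hy p hp, partialX_eqOn hU hx p hp, partialY_eqOn hU hy p hp]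

theorem isOpen_lt_rad (R : ℝ) : IsOpen {p : ℝ × ℝ | R < rad p} :=
  isOpen_lt continuous_const continuous_rad

theorem partialX_rawLyapunov {κ : ℝ} (hκ : 0 < κ) {p : ℝ × ℝ} (h : 0 < rad p) :
    partialX (rawLyapunov κ) p = 4 * p.1 / (p.1 ^ 2 + p.2 ^ 2)
      - gradCoeff κ (pot (3 * κ / 10) p) * potX p :=
  (hasDerivAt_rawLyapunov_fst hκ (x := p.1) (y := p.2) h).deriv

theorem partialY_rawLyapunov {κ : ℝ} (hκ : 0 < κ) {p : ℝ × ℝ} (h : 0 < rad p) :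
    partialY (rawLyapunov κ) p = 4 * p.2 / (p.1 ^ 2 + p.2 ^ 2)
      - gradCoeff κ (pot (3 * κ / 10) p) * potY p :=
  (hasDerivAt_rawLyapunov_snd hκ (x := p.1) (y := p.2) h).deriv

theorem partialX_partialX_rawLyapunov {κ : ℝ} (hκ : 0 < κ) {p : ℝ × ℝ} (h : 0 < rad p) :
    partialX (partialX (rawLyapunov κ)) p = 4 * (p.2 ^ 2 - p.1 ^ 2) / (p.1 ^ 2 + p.2 ^ 2) ^ 2
        - gradCoeff κ (pot (3 * κ / 10) p) * (3 * (rad p + p.1) ^ 2 / rad p)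
        + hessCoeff κ (pot (3 * κ / 10) p) * potX p ^ 2 :=
  (partialX_eqOn (isOpen_lt_rad 0) (fun _ hp => partialX_rawLyapunov hκ hp) p h).trans
    (hasDerivAt_rawLyapunov_fst_fst hκ (x := p.1) (y := p.2) h).deriv

theorem partialY_partialY_rawLyapunov {κ : ℝ} (hκ : 0 < κ) {p : ℝ × ℝ} (h : 0 < rad p) :
    partialY (partialY (rawLyapunov κ)) p = 4 * (p.1 ^ 2 - p.2 ^ 2) / (p.1 ^ 2 + p.2 ^ 2) ^ 2
        - gradCoeff κ (pot (3 * κ / 10) p) * (3 * rad p + 2 * p.1 + 3 * p.2 ^ 2 / rad p)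
        + hessCoeff κ (pot (3 * κ / 10) p) * potY p ^ 2 :=
  (partialY_eqOn (isOpen_lt_rad 0) (fun _ hp => partialY_rawLyapunov hκ hp) p h).trans
    (hasDerivAt_rawLyapunov_snd_snd hκ (x := p.1) (y := p.2) h).deriv

theorem abs_gradient_term_le {κ q a C : ℝ} (hκ : 0 < κ) (hq : 3 * κ / 10 ≤ q) (hC : 0 ≤ C)
    (ha : |a| ≤ C * q) : |gradCoeff κ q * a| ≤ 8 * C := by
  have h0 : 0 < q := by linarith
  have hg := gradCoeff_nonneg hκ h0
  rw [abs_mul, abs_of_nonneg hg]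
  calc gradCoeff κ q * |a| ≤ gradCoeff κ q * (C * q) := mul_le_mul_of_nonneg_left ha hg
    _ = gradCoeff κ q * q * C := by ring
    _ ≤ 8 * C := mul_le_mul_of_nonneg_right (gradCoeff_mul_le hκ hq) hC

/-- The second derivatives of `2 log (x² + y²)` are bounded off the unit disc. -/
theorem four_mul_sub_div_le {u v : ℝ} (hu : 0 ≤ u) (hv : 0 ≤ v) (h : 1 ≤ u + v) :
    4 * (u - v) / (u + v) ^ 2 ≤ 4 := by
  rw [div_le_iff₀ (by positivity)]
  nlinarith

/-- First-order terms coming from the constant part `α` of the drift are `o(r)`, here at most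
`r / 2` up to a constant. -/
theorem exists_linear_drift_bound {κ : ℝ} (hκ : 0 < κ) (a₁ a₂ : ℝ) :
    ∃ K, ∀ p : ℝ × ℝ, 1 ≤ rad p →
      a₁ * partialX (rawLyapunov κ) p + a₂ * partialY (rawLyapunov κ) p ≤ rad p / 2 + K := by
  set m := 3 * κ / 10 with hm
  have hm0 : 0 < m := by positivity
  set η := m / (80 * (|a₂| + 1)) with hη
  have hA : 0 ≤ |a₂| := abs_nonneg _
  have hη0 : 0 < η := by positivity
  refine ⟨|a₁| * 28 + |a₂| * (4 + 40 / η), fun p hp => ?_⟩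
  have hr : 0 < rad p := by linarith
  have hsq := rad_sq p
  have hx := abs_le.1 (abs_fst_le_rad p)
  have hq : pot m p = rad p ^ 2 * (rad p + p.1) + m := rfl
  have h0 := rad_add_fst_nonneg p
  have hv : 0 ≤ rad p ^ 2 * (rad p + p.1) := by positivity
  have hqm := le_pot m p
  have bx : |4 * p.1 / (p.1 ^ 2 + p.2 ^ 2)| ≤ 4 := by
    rw [← hsq, abs_div, abs_mul, abs_of_pos (by positivity : 0 < rad p ^ 2),
      abs_of_pos (by norm_num : (0 : ℝ) < 4), div_le_iff₀ (by positivity)]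
    nlinarith [abs_fst_le_rad p]
  have bY : |4 * p.2 / (p.1 ^ 2 + p.2 ^ 2)| ≤ 4 := by
    rw [← hsq, abs_div, abs_mul, abs_of_pos (by positivity : 0 < rad p ^ 2),
      abs_of_pos (by norm_num : (0 : ℝ) < 4), div_le_iff₀ (by positivity)]
    nlinarith [abs_snd_le_rad p]
  have gx : |gradCoeff κ (pot m p) * potX p| ≤ 8 * 3 := by
    refine abs_gradient_term_le hκ hqm (by norm_num) ?_
    rw [potX, abs_mul, abs_of_nonneg h0]
    have : |rad p + 2 * p.1| ≤ 3 * rad p := abs_le.2 ⟨by linarith, by linarith⟩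
    calc (rad p + p.1) * |rad p + 2 * p.1| ≤ (rad p + p.1) * (3 * rad p) := by gcongr
      _ ≤ 3 * (rad p ^ 2 * (rad p + p.1)) := by
          nlinarith [mul_nonneg (mul_nonneg h0 hr.le) (sub_nonneg.2 hp)]
      _ ≤ 3 * pot m p := by linarith
  have gy : |gradCoeff κ (pot m p) * potY p| ≤ 8 * (5 * (η / m * rad p + 1 / η)) := by
    refine abs_gradient_term_le hκ hqm (by positivity) ?_
    rw [potY, abs_mul]
    have : |3 * rad p + 2 * p.1| ≤ 5 * rad p := abs_le.2 ⟨by linarith, by linarith⟩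
    have h3 := rad_mul_abs_le (y := p.2) hr.le h0 hm0 hη0 hq (by linarith)
    calc |p.2| * |3 * rad p + 2 * p.1| ≤ |p.2| * (5 * rad p) := by gcongr
      _ = 5 * (rad p * |p.2|) := by ring
      _ ≤ 5 * ((η / m * rad p + 1 / η) * pot m p) := by gcongr
      _ = _ := by ring
  rw [partialX_rawLyapunov hκ hr, partialY_rawLyapunov hκ hr]
  have e1 : a₁ * (4 * p.1 / (p.1 ^ 2 + p.2 ^ 2) - gradCoeff κ (pot m p) * potX p)
      ≤ |a₁| * 28 := by
    refine (le_abs_self _).trans ?_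
    rw [abs_mul]
    exact mul_le_mul_of_nonneg_left ((abs_sub _ _).trans (by linarith)) (abs_nonneg _)
  have e2 : a₂ * (4 * p.2 / (p.1 ^ 2 + p.2 ^ 2) - gradCoeff κ (pot m p) * potY p)
      ≤ |a₂| * (4 + 40 * (η / m * rad p + 1 / η)) := by
    refine (le_abs_self _).trans ?_
    rw [abs_mul]
    exact mul_le_mul_of_nonneg_left ((abs_sub _ _).trans (by linarith)) (abs_nonneg _)
  -- the choice of `η` makes the coefficient of `r` at most `1 / 2`
  have e3 : |a₂| * (40 * (η / m * rad p)) ≤ rad p / 2 := by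
    have : |a₂| * (40 * (η / m * rad p)) = |a₂| / (|a₂| + 1) * (rad p / 2) := by
      rw [hη]; field_simp; ring
    rw [this]
    exact mul_le_of_le_one_left (by positivity) ((div_le_one (by positivity)).2 (by linarith))
  have e4 : |a₂| * (4 + 40 * (η / m * rad p + 1 / η))
    = |a₂| * (40 * (η / m * rad p)) + |a₂| * (4 + 40 / η) := by ring
  linarith

/-- The central estimate: near infinity the generator is at most `-r / 2` up to a constant, in all
directions and for every nonnegative coefficient `c` of `y⁻¹`. -/
theorem exists_scaledGenerator_rawLyapunov_le {c κ₁ κ₂ : ℝ} (hc : 0 ≤ c) (hκ₁ : 0 ≤ κ₁)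
    (hκ₂ : 0 < κ₂) (α : ℂ) :
    ∃ K, ∀ p : ℝ × ℝ, 1 ≤ rad p →
      scaledGenerator c κ₁ κ₂ α (rawLyapunov κ₂) p ≤ -(rad p / 2) + K := by
  obtain ⟨K, hK⟩ := exists_linear_drift_bound hκ₂ α.re α.im
  refine ⟨K + 4 * c + 139 * κ₁ + 244 * κ₂, fun p hp => ?_⟩
  set m := 3 * κ₂ / 10 with hm
  have hm0 : 0 < m := by positivity
  have hr : 0 < rad p := by linarith
  have hK := hK p hp
  have hsq := rad_sq p
  have hx := abs_le.1 (abs_fst_le_rad p)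
  have h0 := rad_add_fst_nonneg p
  have hv : 0 ≤ rad p ^ 2 * (rad p + p.1) := by positivity
  have hq : pot m p = rad p ^ 2 * (rad p + p.1) + m := rfl
  have hqm := le_pot m p
  have hq0 := pot_pos hm0 p
  have hg := gradCoeff_nonneg hκ₂ hq0
  have hr2 : 1 ≤ p.1 ^ 2 + p.2 ^ 2 := by rw [← hsq]; exact one_le_pow₀ hp
  have main := drift_add_diffusion_le (h := rad p + p.1) hκ₂ hp h0 (by linarith) hq
  -- the quadratic drift acts on `2 log (x² + y²)` as `-4x`
  have t1 : -(p.1 ^ 2 - p.2 ^ 2) * (4 * p.1 / (p.1 ^ 2 + p.2 ^ 2))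
      - 2 * p.1 * p.2 * (4 * p.2 / (p.1 ^ 2 + p.2 ^ 2)) = -4 * p.1 := by
    field_simp; ring
  have t2 : (p.1 ^ 2 - p.2 ^ 2) * potX p + 2 * p.1 * p.2 * potY p
      = -(rad p ^ 2 * (rad p + p.1) * (5 * rad p - 4 * (rad p + p.1))) := by
    have hy : p.2 ^ 2 = rad p ^ 2 - p.1 ^ 2 := by linarith
    have : (p.1 ^ 2 - p.2 ^ 2) * potX p + 2 * p.1 * p.2 * potY p
        = (p.1 ^ 2 - p.2 ^ 2) * potX p + 2 * p.1 * p.2 ^ 2 * (3 * rad p + 2 * p.1) := by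
      unfold potY; ring
    rw [this, hy, potX]; ring
  have t3 : 3 * rad p + 2 * p.1 + 3 * p.2 ^ 2 / rad p
      = rad p + 8 * (rad p + p.1) - 3 * (rad p + p.1) ^ 2 / rad p := by
    have hy : p.2 ^ 2 = rad p ^ 2 - p.1 ^ 2 := by linarith
    rw [hy]; field_simp; ring
  have t4 : potY p ^ 2 = (rad p + p.1) * (2 * rad p - (rad p + p.1))
      * (rad p + 2 * (rad p + p.1)) ^ 2 := by
    have hy : p.2 ^ 2 = rad p ^ 2 - p.1 ^ 2 := by linarith
    rw [potY, mul_pow, hy]; ring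
  have b1 : κ₂ * (4 * (p.1 ^ 2 - p.2 ^ 2) / (p.1 ^ 2 + p.2 ^ 2) ^ 2) ≤ κ₂ * 4 :=
    mul_le_mul_of_nonneg_left (four_mul_sub_div_le (sq_nonneg _) (sq_nonneg _) hr2) hκ₂.le
  have b2 : κ₁ * (4 * (p.2 ^ 2 - p.1 ^ 2) / (p.1 ^ 2 + p.2 ^ 2) ^ 2
        - gradCoeff κ₂ (pot m p) * (3 * (rad p + p.1) ^ 2 / rad p)
        + hessCoeff κ₂ (pot m p) * potX p ^ 2) ≤ κ₁ * 139 := by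
    refine mul_le_mul_of_nonneg_left ?_ hκ₁
    have i1 := four_mul_sub_div_le (sq_nonneg p.2) (sq_nonneg p.1) (by linarith)
    rw [add_comm (p.2 ^ 2)] at i1
    have i2 : 0 ≤ gradCoeff κ₂ (pot m p) * (3 * (rad p + p.1) ^ 2 / rad p) := by positivity
    have i3 : hessCoeff κ₂ (pot m p) * potX p ^ 2 ≤ 15 * 9 := by
      refine hess_mul_le_of_sq_le hκ₂ hqm (by norm_num) ?_
      have : (rad p + 2 * p.1) ^ 2 ≤ (3 * rad p) ^ 2 := sq_le_sq' (by linarith) (by linarith)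
      calc potX p ^ 2 = (rad p + p.1) ^ 2 * (rad p + 2 * p.1) ^ 2 := by unfold potX; ring
        _ ≤ (rad p + p.1) ^ 2 * (3 * rad p) ^ 2 := by gcongr
        _ = 9 * (rad p * (rad p + p.1)) ^ 2 := by ring
        _ ≤ 9 * pot m p ^ 2 := by
            gcongr
            nlinarith [mul_nonneg (mul_nonneg h0 hr.le) (sub_nonneg.2 hp)]
    linarith
  -- `∂_y` of the Lyapunov function carries a factor `y` that cancels `y⁻¹`
  have b3 : c * p.2⁻¹ * (4 * p.2 / (p.1 ^ 2 + p.2 ^ 2)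
      - gradCoeff κ₂ (pot m p) * potY p) ≤ 4 * c := by
    have j1 : c * p.2⁻¹ * (4 * p.2 / (p.1 ^ 2 + p.2 ^ 2) - gradCoeff κ₂ (pot m p) * potY p)
        = c * (p.2⁻¹ * p.2) * (4 / (p.1 ^ 2 + p.2 ^ 2)
          - gradCoeff κ₂ (pot m p) * (3 * rad p + 2 * p.1)) := by unfold potY; ring
    have j2 : 4 / (p.1 ^ 2 + p.2 ^ 2) ≤ 4 := by
      rw [div_le_iff₀ (by linarith)]; linarith
    have j3 : 0 ≤ gradCoeff κ₂ (pot m p) * (3 * rad p + 2 * p.1) :=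
      mul_nonneg hg (by linarith)
    rw [j1]
    rcases eq_or_ne p.2 0 with h | h
    · simp [h, hc]
    · rw [inv_mul_cancel₀ h, mul_one, mul_comm 4 c]
      exact mul_le_mul_of_nonneg_left (by linarith) hc
  rw [partialX_rawLyapunov hκ₂ hr, partialY_rawLyapunov hκ₂ hr] at hK
  rw [scaledGenerator, partialX_rawLyapunov hκ₂ hr, partialY_rawLyapunov hκ₂ hr,
    partialX_partialX_rawLyapunov hκ₂ hr, partialY_partialY_rawLyapunov hκ₂ hr]
  rw [← t3, ← t4] at main
  generalize 4 * p.1 / (p.1 ^ 2 + p.2 ^ 2) = ux at *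
  generalize 4 * p.2 / (p.1 ^ 2 + p.2 ^ 2) = uy at *
  generalize 4 * (p.2 ^ 2 - p.1 ^ 2) / (p.1 ^ 2 + p.2 ^ 2) ^ 2 = uxx at *
  generalize 4 * (p.1 ^ 2 - p.2 ^ 2) / (p.1 ^ 2 + p.2 ^ 2) ^ 2 = uyy at *
  generalize 3 * (rad p + p.1) ^ 2 / rad p = qxx at *
  generalize 3 * rad p + 2 * p.1 + 3 * p.2 ^ 2 / rad p = qyy at *
  generalize rad p ^ 2 * (rad p + p.1) * (5 * rad p - 4 * (rad p + p.1)) = w at *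
  generalize gradCoeff κ₂ (pot m p) = g at *
  have t5 : g * -w = g * ((p.1 ^ 2 - p.2 ^ 2) * potX p + 2 * p.1 * p.2 * potY p) := by rw [t2]
  calc _ = (-(p.1 ^ 2 - p.2 ^ 2) * ux - 2 * p.1 * p.2 * uy)
        + g * ((p.1 ^ 2 - p.2 ^ 2) * potX p + 2 * p.1 * p.2 * potY p)
        + (α.re * (ux - g * potX p) + α.im * (uy - g * potY p))
        + c * p.2⁻¹ * (uy - g * potY p)
        + κ₁ * (uxx - g * qxx + hessCoeff κ₂ (pot m p) * potX p ^ 2)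
        + κ₂ * uyy + κ₂ * (-g * qyy + hessCoeff κ₂ (pot m p) * potY p ^ 2) := by ring
    _ ≤ _ := by rw [t1, ← t5]; linarith

/-! ### Partial derivatives of smooth functions -/

theorem partialX_eq_fderiv {f : ℝ × ℝ → ℝ} (hf : Differentiable ℝ f) (p : ℝ × ℝ) :
    partialX f p = fderiv ℝ f p (1, 0) := by
  have h : HasDerivAt (fun s : ℝ => (s, p.2)) (1, 0) p.1 :=
    (hasDerivAt_id _).prodMk (hasDerivAt_const _ _)
  exact ((hf (p.1, p.2)).hasFDerivAt.comp_hasDerivAt p.1 h).deriv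

theorem partialY_eq_fderiv {f : ℝ × ℝ → ℝ} (hf : Differentiable ℝ f) (p : ℝ × ℝ) :
    partialY f p = fderiv ℝ f p (0, 1) := by
  have h : HasDerivAt (fun s : ℝ => (p.1, s)) (0, 1) p.2 :=
    (hasDerivAt_const _ _).prodMk (hasDerivAt_id _)
  exact ((hf (p.1, p.2)).hasFDerivAt.comp_hasDerivAt p.2 h).deriv

theorem contDiff_partialX {f : ℝ × ℝ → ℝ} (hf : ContDiff ℝ ∞ f) : ContDiff ℝ ∞ (partialX f) := by
  rw [funext (partialX_eq_fderiv (hf.differentiable (by simp)))]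
  exact (hf.fderiv_right (m := ∞) (by simp)).clm_apply contDiff_const

theorem contDiff_partialY {f : ℝ × ℝ → ℝ} (hf : ContDiff ℝ ∞ f) : ContDiff ℝ ∞ (partialY f) := by
  rw [funext (partialY_eq_fderiv (hf.differentiable (by simp)))]
  exact (hf.fderiv_right (m := ∞) (by simp)).clm_apply contDiff_const

theorem differentiableAt_slice_snd {f : ℝ × ℝ → ℝ} (hf : ContDiff ℝ ∞ f) (x y : ℝ) :
    DifferentiableAt ℝ (fun s => f (x, s)) y := by
  have : Differentiable ℝ f := hf.differentiable (by simp)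
  exact (this (x, y)).comp y (by fun_prop)

theorem isCompact_rad_le (R : ℝ) : IsCompact {p : ℝ × ℝ | rad p ≤ R} := by
  refine (isCompact_closedBall (0 : ℝ × ℝ) R).of_isClosed_subset
    (isClosed_le continuous_rad continuous_const) fun p hp => ?_
  rw [mem_closedBall_zero_iff, Prod.norm_def]
  exact max_le ((abs_fst_le_rad p).trans hp) ((abs_snd_le_rad p).trans hp)

/-- On a bounded set the only unbounded coefficient of the generator is that of `y⁻¹ ∂_y`. -/
theorem exists_scaledGenerator_le_on_disc (c κ₁ κ₂ : ℝ) (α : ℂ) {f : ℝ × ℝ → ℝ}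
    (hf : ContDiff ℝ ∞ f) (R : ℝ) :
    ∃ K, 0 ≤ K ∧ ∀ p : ℝ × ℝ, rad p ≤ R →
      scaledGenerator c κ₁ κ₂ α f p ≤ K * (1 + |p.2⁻¹|) := by
  have cx := (contDiff_partialX hf).continuous
  have cy := (contDiff_partialY hf).continuous
  have cxx := (contDiff_partialX (contDiff_partialX hf)).continuous
  have cyy := (contDiff_partialY (contDiff_partialY hf)).continuous
  obtain ⟨K₁, hK₁⟩ := (isCompact_rad_le R).exists_bound_of_continuousOn
    (f := fun p : ℝ × ℝ => -(p.1 ^ 2 - p.2 ^ 2 - α.re) * partialX f p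
      - (2 * p.1 * p.2 - α.im) * partialY f p
      + κ₁ * partialX (partialX f) p + κ₂ * partialY (partialY f) p)
    (Continuous.continuousOn (by fun_prop))
  obtain ⟨K₂, hK₂⟩ := (isCompact_rad_le R).exists_bound_of_continuousOn
    (f := fun p : ℝ × ℝ => c * partialY f p) (Continuous.continuousOn (by fun_prop))
  refine ⟨max 0 (max K₁ K₂), le_max_left _ _, fun p hp => ?_⟩
  have h1 := (le_abs_self _).trans (hK₁ p hp)
  have h2 := hK₂ p hp
  have h3 : p.2⁻¹ * (c * partialY f p) ≤ |p.2⁻¹| * max 0 (max K₁ K₂) := by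
    refine (le_abs_self _).trans ?_
    rw [abs_mul]
    exact mul_le_mul_of_nonneg_left
      (h2.trans ((le_max_right _ _).trans (le_max_right _ _))) (abs_nonneg _)
  have h4 : K₁ ≤ max 0 (max K₁ K₂) := (le_max_left _ _).trans (le_max_right _ _)
  calc scaledGenerator c κ₁ κ₂ α f p
      = (-(p.1 ^ 2 - p.2 ^ 2 - α.re) * partialX f p - (2 * p.1 * p.2 - α.im) * partialY f p
          + κ₁ * partialX (partialX f) p + κ₂ * partialY (partialY f) p)
        + p.2⁻¹ * (c * partialY f p) := by unfold scaledGenerator; ring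
    _ ≤ max 0 (max K₁ K₂) + |p.2⁻¹| * max 0 (max K₁ K₂) := add_le_add (h1.trans h4) h3
    _ = _ := by ring

/-! ### Growth and smooth truncation -/

theorem rawLyapunov_nonpos {κ : ℝ} (hκ : 0 < κ) {p : ℝ × ℝ} (hp : rad p ≤ 1) :
    rawLyapunov κ p ≤ 0 := by
  have hm : 0 < 3 * κ / 10 := by positivity
  have hq := le_pot (3 * κ / 10) p
  have hq0 := pot_pos hm p
  have h1 : Real.log (p.1 ^ 2 + p.2 ^ 2) ≤ 0 := by
    refine Real.log_nonpos (by positivity) ?_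
    rw [← rad_sq]; exact pow_le_one₀ (rad_nonneg p) hp
  have h2 := Real.log_le_log hm hq
  have h3 : 2 * κ / pot (3 * κ / 10) p ≤ 7 := by
    rw [div_le_iff₀ hq0]; linarith
  unfold rawLyapunov; linarith

theorem log_rad_le_rawLyapunov {κ : ℝ} (hκ : 0 < κ) {p : ℝ × ℝ} (hp : 1 ≤ rad p) :
    Real.log (rad p) - (Real.log (2 + 3 * κ / 10) + (7 - Real.log (3 * κ / 10)))
      ≤ rawLyapunov κ p := by
  have hm : 0 < 3 * κ / 10 := by positivity
  have hq0 := pot_pos hm p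
  have hr : 0 < rad p := by linarith
  have h1 : pot (3 * κ / 10) p ≤ rad p ^ 3 * (2 + 3 * κ / 10) := by
    have := one_le_pow₀ hp (n := 3)
    have h2 : rad p + p.1 ≤ 2 * rad p := by linarith [(abs_le.1 (abs_fst_le_rad p)).2]
    have h3 := mul_le_mul_of_nonneg_left h2 (sq_nonneg (rad p))
    have h4 := le_mul_of_one_le_left hm.le this
    unfold pot; linarith
  have h2 := Real.log_le_log hq0 h1
  rw [Real.log_mul (by positivity) (by positivity), Real.log_pow] at h2
  have h3 : 0 ≤ 2 * κ / pot (3 * κ / 10) p := by positivity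
  have h4 : Real.log (p.1 ^ 2 + p.2 ^ 2) = 2 * Real.log (rad p) := by
    rw [← rad_sq, Real.log_pow]; norm_num
  unfold rawLyapunov
  rw [h4]; push_cast at h2; linarith

theorem exists_le_rawLyapunov {κ : ℝ} (hκ : 0 < κ) (M : ℝ) :
    ∃ R, 1 ≤ R ∧ ∀ p : ℝ × ℝ, R ≤ rad p → M ≤ rawLyapunov κ p := by
  set C := Real.log (2 + 3 * κ / 10) + (7 - Real.log (3 * κ / 10))
  refine ⟨max 1 (Real.exp (M + C)), le_max_left _ _, fun p hp => ?_⟩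
  have h1 : 1 ≤ rad p := (le_max_left _ _).trans hp
  have h2 := log_rad_le_rawLyapunov hκ h1
  have h3 : M + C ≤ Real.log (rad p) :=
    (Real.le_log_iff_exp_le (by linarith)).2 ((le_max_right _ _).trans hp)
  linarith

theorem contDiffAt_rawLyapunov {κ : ℝ} (hκ : 0 < κ) {p : ℝ × ℝ} (hp : 0 < rad p) :
    ContDiffAt ℝ ∞ (rawLyapunov κ) p := by
  have h0 : p.1 ^ 2 + p.2 ^ 2 ≠ 0 := sq_add_sq_ne_zero_of_rad_pos hp
  have hq := (pot_pos (by positivity : 0 < 3 * κ / 10) p).ne'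
  have hs : ContDiffAt ℝ ∞ (fun p : ℝ × ℝ => p.1 ^ 2 + p.2 ^ 2) p := by fun_prop
  have hr : ContDiffAt ℝ ∞ rad p := hs.sqrt h0
  have hpot : ContDiffAt ℝ ∞ (pot (3 * κ / 10)) p := by unfold pot; fun_prop
  exact (((contDiffAt_const.mul (hs.log h0)).sub (hpot.log hq)).add
    (contDiffAt_const.div hpot hq)).sub contDiffAt_const

/-- The Lyapunov function on the whole plane: `rawLyapunov` truncated to its positive part by a
smooth cutoff, so that it vanishes on the unit disc. -/
def planeLyapunov (κ : ℝ) (p : ℝ × ℝ) : ℝ :=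
  rawLyapunov κ p * Real.smoothTransition (rawLyapunov κ p)

theorem planeLyapunov_nonneg (κ : ℝ) (p : ℝ × ℝ) : 0 ≤ planeLyapunov κ p := by
  unfold planeLyapunov
  rcases le_total (rawLyapunov κ p) 0 with h | h
  · rw [Real.smoothTransition.zero_of_nonpos h, mul_zero]
  · exact mul_nonneg h (Real.smoothTransition.nonneg _)

theorem planeLyapunov_eq {κ : ℝ} {p : ℝ × ℝ} (h : 1 ≤ rawLyapunov κ p) :
    planeLyapunov κ p = rawLyapunov κ p := by
  rw [planeLyapunov, Real.smoothTransition.one_of_one_le h, mul_one]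

theorem contDiff_planeLyapunov {κ : ℝ} (hκ : 0 < κ) : ContDiff ℝ ∞ (planeLyapunov κ) := by
  rw [contDiff_iff_contDiffAt]
  intro p
  rcases (rad_nonneg p).eq_or_lt with h | h
  · refine (contDiffAt_const (c := (0 : ℝ))).congr_of_eventuallyEq ?_
    filter_upwards [(isOpen_lt continuous_rad continuous_const).mem_nhds
      (show rad p < 1 by linarith)] with q hq
    rw [planeLyapunov, Real.smoothTransition.zero_of_nonpos (rawLyapunov_nonpos hκ (le_of_lt hq)),
      mul_zero]
  · exact (contDiffAt_rawLyapunov hκ h).mul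
      (Real.smoothTransition.contDiffAt.comp p (contDiffAt_rawLyapunov hκ h))

theorem exists_scaledGenerator_planeLyapunov_le {c κ₁ κ₂ : ℝ} (hc : 0 ≤ c) (hκ₁ : 0 ≤ κ₁)
    (hκ₂ : 0 < κ₂) (α : ℂ) :
    ∃ R K, ∀ p : ℝ × ℝ, R < rad p →
      scaledGenerator c κ₁ κ₂ α (planeLyapunov κ₂) p ≤ -(rad p / 2) + K := by
  obtain ⟨R, hR, h⟩ := exists_le_rawLyapunov hκ₂ 1
  obtain ⟨K, hK⟩ := exists_scaledGenerator_rawLyapunov_le hc hκ₁ hκ₂ α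
  refine ⟨R, K, fun p hp => ?_⟩
  rw [scaledGenerator_eqOn (isOpen_lt_rad R)
    (fun q hq => planeLyapunov_eq (h q (le_of_lt hq))) p hp]
  exact hK p (hR.trans (le_of_lt hp))

/-! ### The barrier at the line `y = 0` -/

/-- The function of `y` that keeps the half-plane process off the line `y = 0`. -/
def barrier (y : ℝ) : ℝ := Real.log (1 + Real.log (1 + y⁻¹))

theorem log_one_add_inv_nonneg {y : ℝ} (hy : 0 < y) : 0 ≤ Real.log (1 + y⁻¹) :=
  Real.log_nonneg (by have : 0 < y⁻¹ := by positivity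
                      linarith)

theorem barrier_nonneg {y : ℝ} (hy : 0 < y) : 0 ≤ barrier y :=
  Real.log_nonneg (by linarith [log_one_add_inv_nonneg hy])

theorem hasDerivAt_log_one_add_inv {y : ℝ} (hy : 0 < y) :
    HasDerivAt (fun s => 1 + Real.log (1 + s⁻¹)) (-1 / (y * (1 + y))) y := by
  have h1 : 1 + y⁻¹ ≠ 0 := by positivity
  refine ((((hasDerivAt_inv hy.ne').const_add 1).log h1).const_add 1).congr_deriv ?_
  field_simp
  ring

theorem hasDerivAt_barrier {y : ℝ} (hy : 0 < y) :
    HasDerivAt barrier (-1 / (y * (1 + y) * (1 + Real.log (1 + y⁻¹)))) y := by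
  have hs : 0 < 1 + Real.log (1 + y⁻¹) := by linarith [log_one_add_inv_nonneg hy]
  refine ((hasDerivAt_log_one_add_inv hy).log hs.ne').congr_deriv ?_
  field_simp

theorem hasDerivAt_barrier_deriv {y : ℝ} (hy : 0 < y) :
    HasDerivAt (fun s => -1 / (s * (1 + s) * (1 + Real.log (1 + s⁻¹))))
      (((1 + 2 * y) * (1 + Real.log (1 + y⁻¹)) - 1)
        / (y * (1 + y) * (1 + Real.log (1 + y⁻¹))) ^ 2) y := by
  have hs : 0 < 1 + Real.log (1 + y⁻¹) := by linarith [log_one_add_inv_nonneg hy]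
  have h := (hasDerivAt_const y (-1 : ℝ)).div
    (((hasDerivAt_id y).mul ((hasDerivAt_id y).const_add 1)).mul (hasDerivAt_log_one_add_inv hy))
    (by simp only [Pi.mul_apply, id]; positivity)
  refine h.congr_deriv ?_
  simp only [Pi.mul_apply, id]
  field_simp
  ring

/-- The contribution of the barrier to the generator. The hypothesis `κ ≤ c` makes the
`y⁻²`-terms cancel up to the logarithmically smaller negative one. -/
theorem barrier_generator_le {c κ x y a : ℝ} (hy : 0 < y) (hκ : 0 < κ) (hc : κ ≤ c) :
    -(2 * x * y - a - c * y⁻¹) * (-1 / (y * (1 + y) * (1 + Real.log (1 + y⁻¹))))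
      + κ * (((1 + 2 * y) * (1 + Real.log (1 + y⁻¹)) - 1)
        / (y * (1 + y) * (1 + Real.log (1 + y⁻¹))) ^ 2)
      ≤ 2 * |x| + (|a| + κ) * y⁻¹ - κ / (y * (1 + y) * (1 + Real.log (1 + y⁻¹))) ^ 2 := by
  have hs : 1 ≤ 1 + Real.log (1 + y⁻¹) := by linarith [log_one_add_inv_nonneg hy]
  set s := 1 + Real.log (1 + y⁻¹)
  have hs0 : 0 < s := by linarith
  have e : -(2 * x * y - a - c * y⁻¹) * (-1 / (y * (1 + y) * s))
      + κ * (((1 + 2 * y) * s - 1) / (y * (1 + y) * s) ^ 2)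
      = 2 * x * (1 / ((1 + y) * s)) + (-a) * y⁻¹ * (1 / ((1 + y) * s))
        - (c - κ) * (1 / (y ^ 2 * (1 + y) * s)) + κ * y⁻¹ * (1 / ((1 + y) ^ 2 * s))
        - κ / (y * (1 + y) * s) ^ 2 := by
    field_simp; ring
  have h1 : 1 / ((1 + y) * s) ≤ 1 := (div_le_one (by positivity)).2 (by nlinarith)
  have h1' : 0 ≤ 1 / ((1 + y) * s) := by positivity
  have h2 : 1 / ((1 + y) ^ 2 * s) ≤ 1 := (div_le_one (by positivity)).2 (by nlinarith)
  have i1 : 2 * x * (1 / ((1 + y) * s)) ≤ 2 * |x| :=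
    (mul_le_mul_of_nonneg_right (by linarith [le_abs_self x]) h1').trans
      (mul_le_of_le_one_right (by positivity) h1)
  have i2 : (-a) * y⁻¹ * (1 / ((1 + y) * s)) ≤ |a| * y⁻¹ :=
    (mul_le_mul_of_nonneg_right
      (mul_le_mul_of_nonneg_right (neg_le_abs a) (by positivity)) h1').trans
      (mul_le_of_le_one_right (by positivity) h1)
  have i3 : 0 ≤ (c - κ) * (1 / (y ^ 2 * (1 + y) * s)) :=
    mul_nonneg (by linarith) (by positivity)
  have i4 : κ * y⁻¹ * (1 / ((1 + y) ^ 2 * s)) ≤ κ * y⁻¹ :=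
    mul_le_of_le_one_right (by positivity) h2
  rw [e]; linarith

theorem tendsto_barrier : Tendsto barrier (𝓝[>] 0) atTop := by
  have h1 : Tendsto (fun y : ℝ => 1 + y⁻¹) (𝓝[>] 0) atTop :=
    tendsto_atTop_add_const_left _ _ tendsto_inv_nhdsGT_zero
  exact Real.tendsto_log_atTop.comp
    (tendsto_atTop_add_const_left _ _ (Real.tendsto_log_atTop.comp h1))

/-- Near `y = 0` the barrier term `(y log y)⁻²` beats any multiple of `y⁻¹`. -/
theorem tendsto_barrier_balance (K : ℝ) {κ : ℝ} (hκ : 0 < κ) :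
    Tendsto (fun y : ℝ => K * (1 + y⁻¹)
      - κ / (y * (1 + y) * (1 + Real.log (1 + y⁻¹))) ^ 2) (𝓝[>] 0) atBot := by
  have hpos : ∀ᶠ y : ℝ in 𝓝[>] 0, 0 < y := eventually_mem_nhdsWithin
  have hid : Tendsto (fun y : ℝ => y) (𝓝[>] 0) (𝓝 0) :=
    tendsto_nhdsWithin_of_tendsto_nhds tendsto_id
  have hsq : Tendsto (fun y : ℝ => y ^ (1 / 2 : ℝ)) (𝓝[>] 0) (𝓝 0) := by
    have := hid.rpow_const (p := 1 / 2) (Or.inr (by norm_num))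
    simpa using this
  have hlog : Tendsto (fun y : ℝ => Real.log y * y ^ (1 / 2 : ℝ)) (𝓝[>] 0) (𝓝 0) :=
    tendsto_log_mul_rpow_nhdsGT_zero (by norm_num)
  have hl1 : Tendsto (fun y : ℝ => Real.log (1 + y)) (𝓝[>] 0) (𝓝 0) := by
    have : Tendsto (fun y : ℝ => 1 + y) (𝓝[>] 0) (𝓝 1) := by simpa using hid.const_add 1
    simpa using this.log one_ne_zero
  have hs : Tendsto (fun y : ℝ => y ^ (1 / 2 : ℝ) * (1 + Real.log (1 + y⁻¹))) (𝓝[>] 0) (𝓝 0) := by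
    have := ((hsq.mul (hl1.const_add 1)).sub hlog)
    simp only [add_zero, mul_one, sub_zero] at this
    refine this.congr' ?_
    filter_upwards [hpos] with y hy
    have : 1 + y⁻¹ = (1 + y) / y := by field_simp; ring
    rw [this, Real.log_div (by positivity) hy.ne']
    ring
  -- `(y (1 + y) (1 + log (1 + y⁻¹)))²` is `y` times the following function
  have hden : Tendsto (fun y : ℝ => (1 + y) ^ 2 * (y ^ (1 / 2 : ℝ) * (1 + Real.log (1 + y⁻¹))) ^ 2)
      (𝓝[>] 0) (𝓝[>] 0) := by
    refine tendsto_nhdsWithin_iff.2 ⟨?_, ?_⟩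
    · simpa using ((hid.const_add 1).pow 2).mul (hs.pow 2)
    · filter_upwards [hpos] with y hy
      have := log_one_add_inv_nonneg hy
      have : 0 < 1 + Real.log (1 + y⁻¹) := by linarith
      rw [Set.mem_Ioi]
      positivity
  have hbr : Tendsto (fun y : ℝ => K * (1 + y)
      - κ * ((1 + y) ^ 2 * (y ^ (1 / 2 : ℝ) * (1 + Real.log (1 + y⁻¹))) ^ 2)⁻¹)
      (𝓝[>] 0) atBot := by
    have h1 := (tendsto_inv_nhdsGT_zero.comp hden).const_mul_atTop hκ
    have h2 : Tendsto (fun y : ℝ => K * (1 + y)) (𝓝[>] 0) (𝓝 (K * (1 + 0))) :=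
      (hid.const_add 1).const_mul K
    exact (h2.add_atBot (tendsto_neg_atTop_atBot.comp h1)).congr fun y => (sub_eq_add_neg _ _).symm
  refine (tendsto_inv_nhdsGT_zero.atTop_mul_atBot₀ hbr).congr' ?_
  filter_upwards [hpos] with y hy
  have hss := log_one_add_inv_nonneg hy
  have hy2 : (y ^ (1 / 2 : ℝ)) ^ 2 = y := by
    rw [← Real.rpow_natCast, ← Real.rpow_mul hy.le]; norm_num
  rw [mul_pow, hy2]
  have : 1 + Real.log (1 + y⁻¹) ≠ 0 := by linarith
  field_simp
  ring

/-! ### The filter of convergence to the boundary -/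

theorem eventually_toBoundary {d : ℕ} {P : ℝ × ℝ → Prop} {K : Set (ℝ × ℝ)} (hK : IsCompact K)
    (hKb : ∀ p ∈ K, (p : OnePoint (ℝ × ℝ)) ∉ boundary d)
    (h : ∀ p ∈ stateSpace d, p ∉ K → P p) : ∀ᶠ p in toBoundary d, P p := by
  rw [toBoundary, eventually_inf_principal]
  refine ⟨((↑) '' K : Set (OnePoint (ℝ × ℝ)))ᶜ, ?_,
    fun p hp hs => h p hs fun hpK => hp ⟨p, hpK, rfl⟩⟩
  refine (OnePoint.isOpen_compl_image_coe.2 ⟨hK.isClosed, hK⟩).mem_nhdsSet.2 ?_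
  rintro _ hb ⟨p, hpK, rfl⟩
  exact hKb p hpK hb

theorem eventually_toBoundary_two {P : ℝ × ℝ → Prop} (R : ℝ) (h : ∀ p, R < rad p → P p) :
    ∀ᶠ p in toBoundary 2, P p :=
  eventually_toBoundary (isCompact_rad_le R) (by simp [boundary])
    fun p _ hp => h p (not_le.1 hp)

theorem eventually_toBoundary_of_three_le {d : ℕ} (hd : 3 ≤ d) {P : ℝ × ℝ → Prop} {R η : ℝ}
    (hη : 0 < η) (h : ∀ p : ℝ × ℝ, 0 < p.2 → R < rad p ∨ p.2 < η → P p) :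
    ∀ᶠ p in toBoundary d, P p := by
  have hd2 : d ≠ 2 := by omega
  refine eventually_toBoundary (K := {p | rad p ≤ R} ∩ {p | η ≤ p.2})
    ((isCompact_rad_le R).inter_right (isClosed_le continuous_const continuous_snd)) ?_ ?_
  · rintro p ⟨-, hp⟩
    simp only [Set.mem_ofPred_eq] at hp
    simp only [boundary, hd2, if_false, Set.mem_insert_iff, OnePoint.coe_ne_infty, false_or,
      Set.mem_image, OnePoint.coe_eq_coe, exists_eq_right, Set.mem_ofPred_eq]
    linarith
  · intro p hp hpK
    simp only [stateSpace, hd2, if_false, Set.mem_ofPred_eq] at hp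
    refine h p hp ?_
    by_contra! hc
    exact hpK ⟨hc.1, hc.2⟩

/-! ### The half-plane -/

/-- The Lyapunov function on the half-plane. The weight `1 / 8` keeps the drift of the barrier,
at most `2 r` before weighting, below the gain `r / 2` of `planeLyapunov`. -/
def halfPlaneLyapunov (κ : ℝ) (p : ℝ × ℝ) : ℝ := planeLyapunov κ p + 1 / 8 * barrier p.2

theorem scaledGenerator_halfPlaneLyapunov {c κ₁ κ₂ : ℝ} {α : ℂ} (hκ₂ : 0 < κ₂) {p : ℝ × ℝ}
    (hp : 0 < p.2) :
    scaledGenerator c κ₁ κ₂ α (halfPlaneLyapunov κ₂) p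
      = scaledGenerator c κ₁ κ₂ α (planeLyapunov κ₂) p
        + 1 / 8 * (-(2 * p.1 * p.2 - α.im - c * p.2⁻¹)
            * (-1 / (p.2 * (1 + p.2) * (1 + Real.log (1 + p.2⁻¹))))
          + κ₂ * (((1 + 2 * p.2) * (1 + Real.log (1 + p.2⁻¹)) - 1)
            / (p.2 * (1 + p.2) * (1 + Real.log (1 + p.2⁻¹))) ^ 2)) := by
  have hG := contDiff_planeLyapunov hκ₂
  have hU : IsOpen {p : ℝ × ℝ | 0 < p.2} := isOpen_lt continuous_const continuous_snd
  have hX : partialX (halfPlaneLyapunov κ₂) = partialX (planeLyapunov κ₂) := by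
    funext q
    exact deriv_add_const (f := fun s => planeLyapunov κ₂ (s, q.2)) (x := q.1)
      (1 / 8 * barrier q.2)
  have hY : ∀ q ∈ {p : ℝ × ℝ | 0 < p.2}, partialY (halfPlaneLyapunov κ₂) q
      = partialY (planeLyapunov κ₂) q
        + 1 / 8 * (-1 / (q.2 * (1 + q.2) * (1 + Real.log (1 + q.2⁻¹)))) := fun q hq =>
    ((differentiableAt_slice_snd hG q.1 q.2).hasDerivAt.add
      ((hasDerivAt_barrier hq).const_mul (1 / 8))).deriv
  have hYY : partialY (partialY (halfPlaneLyapunov κ₂)) p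
      = partialY (partialY (planeLyapunov κ₂)) p
        + 1 / 8 * (((1 + 2 * p.2) * (1 + Real.log (1 + p.2⁻¹)) - 1)
          / (p.2 * (1 + p.2) * (1 + Real.log (1 + p.2⁻¹))) ^ 2) :=
    (partialY_eqOn hU hY p hp).trans
      ((differentiableAt_slice_snd (contDiff_partialY hG) p.1 p.2).hasDerivAt.add
        ((hasDerivAt_barrier_deriv hp).const_mul (1 / 8))).deriv
  rw [scaledGenerator, scaledGenerator, hX, hY p hp, hYY]
  ring

theorem exists_scaledGenerator_halfPlaneLyapunov_le {c κ₁ κ₂ : ℝ} (hκ₁ : 0 ≤ κ₁)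
    (hκ₂ : 0 < κ₂) (hc : κ₂ ≤ c) (α : ℂ) :
    ∃ K, 0 ≤ K ∧ ∀ p : ℝ × ℝ, 0 < p.2 →
      scaledGenerator c κ₁ κ₂ α (halfPlaneLyapunov κ₂) p ≤ -(rad p / 4) + (K * (1 + p.2⁻¹)
        - κ₂ / 8 / (p.2 * (1 + p.2) * (1 + Real.log (1 + p.2⁻¹))) ^ 2) := by
  obtain ⟨R, K₁, h₁⟩ := exists_scaledGenerator_planeLyapunov_le (hκ₂.le.trans hc) hκ₁ hκ₂ α
  obtain ⟨K₂, hK₂, h₂⟩ :=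
    exists_scaledGenerator_le_on_disc c κ₁ κ₂ α (contDiff_planeLyapunov hκ₂) R
  refine ⟨|K₁| + |R| + K₂ + |α.im| + κ₂, by positivity, fun p hp => ?_⟩
  have hi : 0 < p.2⁻¹ := by positivity
  have hG : scaledGenerator c κ₁ κ₂ α (planeLyapunov κ₂) p
      ≤ -(rad p / 2) + (|K₁| + |R| + K₂) * (1 + p.2⁻¹) := by
    have j1 : 0 ≤ (|K₁| + |R|) * p.2⁻¹ := by positivity
    have j2 : 0 ≤ K₂ * (1 + p.2⁻¹) := by positivity
    rcases lt_or_ge R (rad p) with h | h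
    · have := h₁ p h
      linarith [le_abs_self K₁, abs_nonneg R]
    · have := h₂ p h
      rw [abs_of_pos hi] at this
      linarith [le_abs_self R, abs_nonneg K₁, rad_nonneg p, abs_nonneg R]
  have hB := barrier_generator_le (x := p.1) (a := α.im) hp hκ₂ hc
  rw [scaledGenerator_halfPlaneLyapunov hκ₂ hp]
  have hx := abs_fst_le_rad p
  have j3 : 0 ≤ (|α.im| + κ₂) * p.2⁻¹ := by positivity
  have j4 : 0 ≤ |α.im| + κ₂ := by positivity
  have j5 : κ₂ / 8 / (p.2 * (1 + p.2) * (1 + Real.log (1 + p.2⁻¹))) ^ 2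
    = 1 / 8 * (κ₂ / (p.2 * (1 + p.2) * (1 + Real.log (1 + p.2⁻¹))) ^ 2) := by ring
  rw [j5]
  linarith

theorem contDiffOn_halfPlaneLyapunov {κ : ℝ} (hκ : 0 < κ) :
    ContDiffOn ℝ ∞ (halfPlaneLyapunov κ) {p | 0 < p.2} := by
  intro p hp
  have hp : 0 < p.2 := hp
  have hs := log_one_add_inv_nonneg hp
  have h1 : ContDiffAt ℝ ∞ (fun q : ℝ × ℝ => 1 + q.2⁻¹) p :=
    contDiffAt_const.add (contDiffAt_snd.inv hp.ne')
  have h2 : ContDiffAt ℝ ∞ (fun q : ℝ × ℝ => barrier q.2) p :=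
    (contDiffAt_const.add (h1.log (by positivity))).log (by positivity)
  exact ((contDiff_planeLyapunov hκ).contDiffAt.add (contDiffAt_const.mul h2)).contDiffWithinAt

/-! ### Limits at the boundary -/

/-- A function on the half-line that tends to `-∞` at `0` and is bounded above by a decreasing
function is bounded above. -/
theorem exists_upper_bound_of_tendsto {f : ℝ → ℝ} {K : ℝ} (hK : 0 ≤ K)
    (hf : Tendsto f (𝓝[>] 0) atBot) (hle : ∀ y, 0 < y → f y ≤ K * (1 + y⁻¹)) :
    ∃ B, ∀ y, 0 < y → f y ≤ B := by
  obtain ⟨η, hη, h⟩ := mem_nhdsGT_iff_exists_Ioo_subset.1 (hf.eventually_le_atBot 0)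
  have hη : 0 < η := hη
  refine ⟨K * (1 + η⁻¹), fun y hy => ?_⟩
  rcases lt_or_ge y η with hlt | hge
  · exact (h ⟨hy, hlt⟩ : f y ≤ 0).trans (by positivity)
  · refine (hle y hy).trans ?_
    gcongr

theorem tendsto_planeLyapunov {c κ₁ κ₂ : ℝ} (hc : 0 ≤ c) (hκ₁ : 0 ≤ κ₁) (hκ₂ : 0 < κ₂) (α : ℂ) :
    Tendsto (planeLyapunov κ₂) (toBoundary 2) atTop ∧
      Tendsto (scaledGenerator c κ₁ κ₂ α (planeLyapunov κ₂)) (toBoundary 2) atBot := by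
  constructor
  · refine tendsto_atTop.2 fun M => ?_
    obtain ⟨R, -, hR⟩ := exists_le_rawLyapunov hκ₂ (max M 1)
    refine eventually_toBoundary_two R fun p hp => ?_
    have h := hR p hp.le
    rw [planeLyapunov_eq ((le_max_right _ _).trans h)]
    exact (le_max_left _ _).trans h
  · refine tendsto_atBot.2 fun M => ?_
    obtain ⟨R, K, h⟩ := exists_scaledGenerator_planeLyapunov_le hc hκ₁ hκ₂ α
    refine eventually_toBoundary_two (max R (2 * (K - M))) fun p hp => ?_
    have := h p ((le_max_left _ _).trans_lt hp)
    have := (le_max_right _ _).trans_lt hp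
    linarith

theorem tendsto_halfPlaneLyapunov {d : ℕ} (hd : 3 ≤ d) {c κ₁ κ₂ : ℝ} (hκ₁ : 0 ≤ κ₁)
    (hκ₂ : 0 < κ₂) (hc : κ₂ ≤ c) (α : ℂ) :
    Tendsto (halfPlaneLyapunov κ₂) (toBoundary d) atTop ∧
      Tendsto (scaledGenerator c κ₁ κ₂ α (halfPlaneLyapunov κ₂)) (toBoundary d) atBot := by
  constructor
  · refine tendsto_atTop.2 fun M => ?_
    obtain ⟨R, -, hR⟩ := exists_le_rawLyapunov hκ₂ (max M 1)
    obtain ⟨η, hη, hB⟩ :=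
      mem_nhdsGT_iff_exists_Ioo_subset.1 (tendsto_barrier.eventually_ge_atTop (8 * M))
    refine eventually_toBoundary_of_three_le hd (R := R) hη fun p hp hor => ?_
    have hb := barrier_nonneg hp
    have hG := planeLyapunov_nonneg κ₂ p
    unfold halfPlaneLyapunov
    rcases hor with h | h
    · have h := hR p h.le
      rw [planeLyapunov_eq ((le_max_right _ _).trans h)]
      linarith [(le_max_left M 1).trans h]
    · have : 8 * M ≤ barrier p.2 := hB ⟨hp, h⟩
      linarith
  · refine tendsto_atBot.2 fun M => ?_
    obtain ⟨K, hK, h⟩ := exists_scaledGenerator_halfPlaneLyapunov_le hκ₁ hκ₂ hc α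
    have ht := tendsto_barrier_balance K (κ := κ₂ / 8) (by positivity)
    obtain ⟨B, hB⟩ := exists_upper_bound_of_tendsto hK ht fun y hy => by
      have : 0 ≤ κ₂ / 8 / (y * (1 + y) * (1 + Real.log (1 + y⁻¹))) ^ 2 := by positivity
      linarith
    obtain ⟨η, hη, hM⟩ := mem_nhdsGT_iff_exists_Ioo_subset.1 (ht.eventually_le_atBot M)
    refine eventually_toBoundary_of_three_le hd (R := 4 * (B - M)) hη fun p hp hor => ?_
    have h1 := h p hp
    rcases hor with hr | hy
    · have := hB p.2 hp
      linarith
    · have : _ ≤ M := hM ⟨hp, hy⟩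
      linarith [rad_nonneg p]

end InertialParticles

end

theorem mainTheorem7 (d : ℕ) (hd : 2 ≤ d) (τ b κ₁ κ₂ : ℝ) (α : ℂ)
    (hτ : 0 < τ) (hb : 0 < b) (hκ₁ : 0 ≤ κ₁) (hκ₂ : 0 < κ₂)
    (hbκ : 3 ≤ d → κ₂ ≤ τ * b * ((d : ℝ) - 2)) :
    ∃ Φ : ℝ × ℝ → ℝ,
      ContDiffOn ℝ ∞ Φ (InertialParticles.stateSpace d) ∧
      (∀ p ∈ InertialParticles.stateSpace d, 0 ≤ Φ p) ∧
      Tendsto Φ (InertialParticles.toBoundary d) atTop ∧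
      Tendsto (InertialParticles.generator d τ b κ₁ κ₂ α Φ)
        (InertialParticles.toBoundary d) atBot := by
  open InertialParticles in
  have hτ' : 0 < 1 / τ := by positivity
  rcases hd.eq_or_lt with rfl | hd3
  · obtain ⟨h1, h2⟩ := tendsto_planeLyapunov
      (show 0 ≤ τ * b * (((2 : ℕ) : ℝ) - 2) by norm_num) hκ₁ hκ₂ α
    refine ⟨planeLyapunov κ₂, (contDiff_planeLyapunov hκ₂).contDiffOn,
      fun p _ => planeLyapunov_nonneg κ₂ p, h1, ?_⟩
    rw [funext (generator_eq 2 b κ₁ κ₂ α _)]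
    exact h2.const_mul_atBot hτ'
  · have hd2 : d ≠ 2 := by omega
    have hS : stateSpace d = {p | 0 < p.2} := by simp [stateSpace, hd2]
    obtain ⟨h1, h2⟩ := tendsto_halfPlaneLyapunov hd3 hκ₁ hκ₂ (hbκ hd3) α
    refine ⟨halfPlaneLyapunov κ₂, hS ▸ contDiffOn_halfPlaneLyapunov hκ₂, fun p hp => ?_, h1, ?_⟩
    · rw [hS] at hp
      have := barrier_nonneg hp
      have := planeLyapunov_nonneg κ₂ p
      unfold halfPlaneLyapunov; positivity
    · rw [funext (generator_eq d b κ₁ κ₂ α _)]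
      exact h2.const_mul_atBot hτ'
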